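/- Let $N\ge 1$, let $\acute H\in\mathbb{R}^{N\times N}$ and ${\bf y}\in\mathbb{R}^N$ be fixed, and write $f({\bf x})=\|{\bf y}-\acute H{\bf x}\|_2^2$ for ${\bf x}\in\{\pm1\}^N$. Assume that no two distinct vectors of $\{\pm1\}^N$ have the same value of $f$. For $\alpha>0$ consider the reversible MCMC chain on $\{\pm1\}^N$ with transition matrix $P_\alpha$: from the state ${\bf x}$, choose a position $j\in\{1,\dots,N\}$ uniformly at random, keep all other entries, and set the $j$-th entry to $\omega\in\{\pm1\}$ with probability $$\frac{e^{-f({\bf x}_{j|\omega})/(2\alpha^2)}}{e^{-f({\bf x}_{j|+1})/(2\alpha^2)}+e^{-f({\bf x}_{j|-1})/(2\alpha^2)}},$$ where ${\bf x}_{j|\omega}$ denotes ${\bf x}$ with its $j$-th entry replaced by $\omega$. Its stationary distribution is $\pi_\alpha({\bf x})\propto e^{-f({\bf x})/(2\alpha^2)}$. Its relaxation time is $\frac{1}{1-\lambda_2}$, where $\lambda_2$ is the second largest eigenvalue of $P_\alpha$ (counted with multiplicity), and its mixing time is $$t_{mix}(\epsilon)=\min\Big\{t\in\mathbb{N}:\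 \max_{{\bf x}}\tfrac12\sum_{{\bf z}}|P_\alpha^t({\bf x},{\bf z})-\pi_\alpha({\bf z})|\le\epsilon\Big\}.$$ A local minimum is a vector ${\bf x}\in\{\pm1\}^N$ that is not a global minimizer of $f$ over $\{\pm1\}^N$ and satisfies $f({\bf x}')>f({\bf x})$ for every ${\bf x}'\in\{\pm1\}^N$ that differs from ${\bf x}$ in exactly one position. Theorem. (1) The relaxation time is bounded by a constant as $\alpha\to0^+$ (that is, there are a constant $C$ and an $\alpha_0>0$, which may depend on $\acute H$ and ${\bf y}$, such that it is at most $C$ for all $0<\alpha<\alpha_0$) if and only if there is no local minimum. (2) If there is a local minimum, then $t_{mix}(\epsilon)=e^{\Omega(1/(2\alpha^2))}$ as $\alpha\to0^+$ for every fixed $0<\epsilon<1$; that is, there is a constant $c>0$, depending only on $\acute H$ and ${\bf y}$, such that for every $0<\epsilon<1$ one has $t_{mix}(\epsilon)\ge e^{c/(2\alpha^2)}$ for all sufficiently small $\alpha>0$. -/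

import Mathlib

open Filter Topology

noncomputable section

namespace ILS

/-- The state space `{-1, +1}^N`; the two-element type `ℤˣ` consists of `-1` and `1`. -/
abbrev State (N : ℕ) : Type := Fin N → ℤˣ

/-- A vector of `{-1, +1}^N` read as a real vector. -/
def State.toReal {N : ℕ} (x : State N) : Fin N → ℝ := fun i => ((x i : ℤ) : ℝ)

/-- The integer least-squares objective `‖y - H x‖²` (Euclidean norm). -/
def objective {N : ℕ} (H : Matrix (Fin N) (Fin N) ℝ) (y : EuclideanSpace ℝ (Fin N))
    (x : State N) : ℝ :=
  ‖y - WithLp.toLp 2 (H.mulVec x.toReal)‖ ^ 2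

/-- `x` is a local minimum: it is not a global minimizer over `{-1, +1}^N`, and every vector that
differs from `x` in exactly one position has a strictly larger objective value. -/
def IsLocalMinimum {N : ℕ} (H : Matrix (Fin N) (Fin N) ℝ) (y : EuclideanSpace ℝ (Fin N))
    (x : State N) : Prop :=
  (¬ ∀ s : State N, objective H y x ≤ objective H y s) ∧
    ∀ j : Fin N, objective H y x < objective H y (Function.update x j (-x j))

/-- The unnormalised weight `exp (-‖y - H x‖² / (2 α²))`. -/
def weight {N : ℕ} (H : Matrix (Fin N) (Fin N) ℝ) (y : EuclideanSpace ℝ (Fin N)) (α : ℝ)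
    (x : State N) : ℝ :=
  Real.exp (-(1 / (2 * α ^ 2)) * objective H y x)

/-- The conditional probability that the `j`-th symbol becomes `ω`, given that position `j` was
selected for updating in state `x`. -/
def symbolProb {N : ℕ} (H : Matrix (Fin N) (Fin N) ℝ) (y : EuclideanSpace ℝ (Fin N)) (α : ℝ)
    (x : State N) (j : Fin N) (ω : ℤˣ) : ℝ :=
  weight H y α (Function.update x j ω) / ∑ ω' : ℤˣ, weight H y α (Function.update x j ω')

/-- The transition matrix of the reversible MCMC detector: a position `j` is chosen uniformly
among the `N` positions, and its symbol is replaced by `ω` with probability `symbolProb`. -/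
def transition {N : ℕ} (H : Matrix (Fin N) (Fin N) ℝ) (y : EuclideanSpace ℝ (Fin N)) (α : ℝ) :
    Matrix (State N) (State N) ℝ :=
  Matrix.of fun x z =>
    ∑ j : Fin N, ∑ ω : ℤˣ,
      (1 / (N : ℝ)) * symbolProb H y α x j ω * (if Function.update x j ω = z then 1 else 0)

/-- The stationary distribution, proportional to `weight`. -/
def stationary {N : ℕ} (H : Matrix (Fin N) (Fin N) ℝ) (y : EuclideanSpace ℝ (Fin N)) (α : ℝ)
    (x : State N) : ℝ :=
  weight H y α x / ∑ s : State N, weight H y α s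

/-- Total variation distance `½ ∑ |μ z - ν z|` on a finite set. -/
def tvDist {S : Type*} [Fintype S] (μ ν : S → ℝ) : ℝ :=
  (1 / 2) * ∑ z : S, |μ z - ν z|

/-- The mixing time: the least `t` such that, for every starting state `x`, the law `P^t (x, ·)` is
within total variation distance `ε` of the stationary distribution. -/
def mixingTime {N : ℕ} (H : Matrix (Fin N) (Fin N) ℝ) (y : EuclideanSpace ℝ (Fin N)) (α ε : ℝ) :
    ℕ :=
  sInf {t : ℕ | ∀ x : State N,
    tvDist (fun z => (transition H y α ^ t) x z) (stationary H y α) ≤ ε}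

/-- The second largest eigenvalue `λ₂` of a square real matrix with real eigenvalues, where the
eigenvalues are listed in decreasing order and repeated according to multiplicity (index `0` of
the list holds the largest one). -/
def secondEigenvalue {S : Type*} [Fintype S] [DecidableEq S] (P : Matrix S S ℝ) : ℝ :=
  (P.charpoly.roots.sort (· ≥ ·)).getD 1 0

/-- The relaxation time `1 / (1 - λ₂)` of the chain, the inverse of its spectral gap. -/
def relaxationTime {N : ℕ} (H : Matrix (Fin N) (Fin N) ℝ) (y : EuclideanSpace ℝ (Fin N)) (α : ℝ) :
    ℝ :=
  1 / (1 - secondEigenvalue (transition H y α))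

end ILS

end

/-! The spectral gap is read off from traces of powers. Detailed balance makes the spectrum real, so
`secondEigenvalue_trace_bounds` bounds `λ₂` above by an even trace and below by an odd one. As `α →
0⁺` the chain converges to a greedy chain (`tendsto_transition`). It never moves to a higher
objective value, so it is triangular and the traces of its powers involve only diagonal entries.
Without a local minimum, all of these but the global minimizer's are at most `1 - 1/N`. Some fixed
even power then has trace below `3/2`, also for small `α`, which keeps `λ₂` away from `1`. With a
local minimum, the holding probabilities there and at the global minimizer both tend to `1`. Every
fixed odd power then has limiting trace at least `2`, which no uniform gap permits. For mixing, a
chain started at the local minimum leaves with probability at most `exp (-c / (2α²))` per step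
(`transition_self_ge`), while the stationary mass there vanishes. -/

namespace ILS

/-! ### Spectra, traces and powers of reversible, triangular and positive matrices. -/

section Matrix

variable {S : Type*} [Fintype S] [DecidableEq S]

/-- A matrix satisfying detailed balance with respect to a positive weight has real spectrum:
its eigenvalues can be listed in decreasing order, and their power sums are the traces of powers. -/
theorem exists_eigenvalues_of_detailed_balance (P : Matrix S S ℝ) (w : S → ℝ)
    (hw : ∀ x, 0 < w x) (hrev : ∀ x z, w x * P x z = w z * P z x) :
    ∃ μ : Fin (Fintype.card S) → ℝ, Antitone μ ∧
      P.charpoly.roots.sort (· ≥ ·) = List.ofFn μ ∧ ∀ k : ℕ, (P ^ k).trace = ∑ i, μ i ^ k := by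
  have hs : ∀ x, 0 < √(w x) := fun x => Real.sqrt_pos.2 (hw x)
  let D : (Matrix S S ℝ)ˣ :=
    ⟨Matrix.diagonal fun x => √(w x), Matrix.diagonal fun x => (√(w x))⁻¹,
      by rw [Matrix.diagonal_mul_diagonal, ← Matrix.diagonal_one]
         congr 1; ext x; exact mul_inv_cancel₀ (hs x).ne',
      by rw [Matrix.diagonal_mul_diagonal, ← Matrix.diagonal_one]
         congr 1; ext x; exact inv_mul_cancel₀ (hs x).ne'⟩
  -- Conjugation by the square roots of the weights turns detailed balance into symmetry.
  set A : Matrix S S ℝ := D.val * P * D⁻¹.val with hAdef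
  have hentry : ∀ x z, A x z = √(w x) * P x z * (√(w z))⁻¹ := fun x z => by
    change (Matrix.diagonal _ * P * Matrix.diagonal _ : Matrix S S ℝ) x z = _
    rw [Matrix.mul_diagonal, Matrix.diagonal_mul]
  have hA : A.IsHermitian := by
    refine Matrix.IsHermitian.ext fun x z => ?_
    rw [star_trivial, hentry, hentry]
    have h := hrev x z
    rw [← Real.mul_self_sqrt (hw x).le, ← Real.mul_self_sqrt (hw z).le] at h
    have := (hs x).ne'
    have := (hs z).ne'
    field_simp
    linear_combination -h
  have hchar : A.charpoly = P.charpoly := by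
    rw [hAdef, Matrix.charpoly_mul_comm, ← mul_assoc, Units.inv_mul, one_mul]
  refine ⟨hA.eigenvalues₀, hA.eigenvalues₀_antitone, ?_, fun k => ?_⟩
  · rw [← hA.sort_roots_charpoly_eq_eigenvalues₀, hchar]
    simp
  · have h1 : A ^ k = D.val * P ^ k * D⁻¹.val := Units.conj_pow D P k
    have h2 : (P ^ k).trace = (A ^ k).trace := by
      rw [h1, Matrix.trace_mul_comm, ← mul_assoc, Units.inv_mul, one_mul]
    have h3 : (A ^ k).trace = ∑ x, hA.eigenvalues x ^ k := by
      conv_lhs => rw [hA.spectral_theorem]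
      rw [← map_pow, Unitary.conjStarAlgAut_apply, Matrix.trace_mul_comm, ← mul_assoc]
      simp [Matrix.diagonal_pow, Matrix.trace_diagonal]
    rw [h2, h3]
    exact Equiv.sum_comp (Fintype.equivOfCardEq (Fintype.card_fin (Fintype.card S))).symm
      (fun i => hA.eigenvalues₀ i ^ k)

/-- Among the nonnegative path weights from `x` to `x`, keep only the constant path. -/
theorem pow_apply_self_ge (P : Matrix S S ℝ) (hP : ∀ x z, 0 ≤ P x z) (x : S) (k : ℕ) :
    (∀ u v, 0 ≤ (P ^ k) u v) ∧ P x x ^ k ≤ (P ^ k) x x := by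
  induction k with
  | zero => exact ⟨fun u v => by rw [pow_zero, Matrix.one_apply]; split_ifs <;> norm_num, by simp⟩
  | succ k ih =>
    refine ⟨fun u v => ?_, ?_⟩
    · rw [pow_succ, Matrix.mul_apply]
      exact Finset.sum_nonneg fun i _ => mul_nonneg (ih.1 _ _) (hP _ _)
    · rw [pow_succ, pow_succ, Matrix.mul_apply]
      exact (mul_le_mul_of_nonneg_right ih.2 (hP x x)).trans
        (Finset.single_le_sum (f := fun i => (P ^ k) x i * P i x)
          (fun i _ => mul_nonneg (ih.1 _ _) (hP _ _)) (Finset.mem_univ x))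

/-- Powers of a matrix that is triangular with respect to a real-valued height function. -/
theorem pow_apply_self_of_triangular (P : Matrix S S ℝ) (f : S → ℝ)
    (h : ∀ x z, x ≠ z → f x ≤ f z → P x z = 0) (k : ℕ) :
    (∀ x z, x ≠ z → f x ≤ f z → (P ^ k) x z = 0) ∧ ∀ x, (P ^ k) x x = P x x ^ k := by
  induction k with
  | zero => exact ⟨fun x z hxz _ => by simp [hxz], fun x => by simp⟩
  | succ k ih =>
    refine ⟨fun x z hxz hf => ?_, fun x => ?_⟩
    · rw [pow_succ, Matrix.mul_apply]
      refine Finset.sum_eq_zero fun i _ => ?_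
      rcases eq_or_ne x i with rfl | hxi
      · rw [h x z hxz hf, mul_zero]
      rcases le_total (f x) (f i) with hi | hi
      · rw [ih.1 x i hxi hi, zero_mul]
      · rcases eq_or_ne i z with rfl | hiz
        · rw [ih.1 x i hxi hf, zero_mul]
        · rw [h i z hiz (hi.trans hf), mul_zero]
    · rw [pow_succ, pow_succ, Matrix.mul_apply, ← ih.2 x]
      refine Finset.sum_eq_single x (fun i _ hi => ?_) (by simp)
      rcases le_total (f x) (f i) with hxi | hxi
      · rw [ih.1 x i hi.symm hxi, zero_mul]
      · rw [h i x hi hxi, mul_zero]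

/-- Doeblin's theorem: a stochastic matrix with positive entries converges to its stationary
distribution. -/
theorem tendsto_pow_of_pos [Nonempty S] (M : Matrix S S ℝ) (π : S → ℝ)
    (hM : ∀ x z, 0 < M x z) (hsum : ∀ x, ∑ z, M x z = 1) (hπ1 : ∀ z, π z ≤ 1)
    (hπsum : ∑ z, π z = 1) (hπ : ∀ z, ∑ x, π x * M x z = π z) (x z : S) :
    Tendsto (fun k : ℕ => (M ^ k) x z) atTop (𝓝 (π z)) := by
  obtain ⟨p, hp⟩ := Finite.exists_min fun p : S × S => M p.1 p.2
  set δ := M p.1 p.2 with hδ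
  have hδ0 : 0 < δ := hM _ _
  set Q : Matrix S S ℝ := Matrix.of fun _ z => π z with hQ
  -- Split off a rank-one part: `R` stays nonnegative because `δ` is the least entry of `M` and `π ≤
  -- 1`; its row sums are `1 - δ`.
  set R : Matrix S S ℝ := M - δ • Q with hR
  have hR0 : ∀ x z, 0 ≤ R x z := fun x z => by
    have h1 := hp (x, z)
    have h2 : δ * π z ≤ δ * 1 := mul_le_mul_of_nonneg_left (hπ1 z) hδ0.le
    simp only [hR, hQ, Matrix.sub_apply, Matrix.smul_apply, Matrix.of_apply, smul_eq_mul]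
    linarith
  have hRsum : ∀ x, ∑ z, R x z = 1 - δ := fun x => by
    simp only [hR, hQ, Matrix.sub_apply, Matrix.smul_apply, Matrix.of_apply, smul_eq_mul,
      Finset.sum_sub_distrib, hsum, ← Finset.mul_sum, hπsum, mul_one]
  have hδ1 : 0 ≤ 1 - δ := by
    obtain ⟨x⟩ := ‹Nonempty S›
    rw [← hRsum x]
    exact Finset.sum_nonneg fun z _ => hR0 x z
  have hQR : Q * R = (1 - δ) • Q := by
    ext x z
    simp only [hR, hQ, Matrix.mul_apply, Matrix.sub_apply, Matrix.smul_apply, Matrix.of_apply,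
      smul_eq_mul, mul_sub, Finset.sum_sub_distrib, hπ, ← Finset.sum_mul, hπsum]
    ring
  have hQQ : Q * Q = Q := by
    ext x z
    simp only [hQ, Matrix.mul_apply, Matrix.of_apply, ← Finset.sum_mul, hπsum, one_mul]
  have hRk : ∀ k : ℕ, (∀ x, ∑ z, (R ^ k) x z = (1 - δ) ^ k) := fun k => by
    induction k with
    | zero => intro x; simp [Matrix.one_apply]
    | succ k ih =>
      intro x
      simp only [pow_succ, Matrix.mul_apply]
      rw [Finset.sum_comm]
      simp only [← Finset.mul_sum, hRsum, ← Finset.sum_mul, ih]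
  have hRQ : ∀ k : ℕ, R ^ k * Q = (1 - δ) ^ k • Q := fun k => by
    ext x z
    simp only [hQ, Matrix.mul_apply, Matrix.smul_apply, Matrix.of_apply, smul_eq_mul,
      ← Finset.sum_mul, hRk]
  have hMk : ∀ k : ℕ, M ^ k = R ^ k + (1 - (1 - δ) ^ k) • Q := fun k => by
    induction k with
    | zero => simp
    | succ k ih =>
      have hMR : M = R + δ • Q := by rw [hR]; abel
      rw [pow_succ, ih]
      conv_lhs => rw [hMR]
      rw [add_mul, mul_add, mul_add, ← pow_succ, Matrix.mul_smul, hRQ, Matrix.smul_mul, hQR,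
        Matrix.smul_mul, Matrix.mul_smul, hQQ, add_assoc]
      congr 1
      simp only [smul_smul, ← add_smul]
      congr 1
      ring
  have hpow : Tendsto (fun k : ℕ => (1 - δ) ^ k) atTop (𝓝 0) :=
    tendsto_pow_atTop_nhds_zero_of_lt_one hδ1 (by linarith)
  have hRlim : Tendsto (fun k : ℕ => (R ^ k) x z) atTop (𝓝 0) := by
    refine squeeze_zero (fun k => (pow_apply_self_ge R hR0 x k).1 x z) (fun k => ?_) hpow
    rw [← hRk k x]
    exact Finset.single_le_sum (f := fun z => (R ^ k) x z)
      (fun i _ => (pow_apply_self_ge R hR0 x k).1 x i) (Finset.mem_univ z)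
  have := hRlim.add ((hpow.const_sub 1).mul_const (π z))
  rw [sub_zero, one_mul, zero_add] at this
  refine this.congr fun k => ?_
  rw [hMk k]
  simp [hQ]

/-- Trace bounds on the second largest eigenvalue of a reversible stochastic matrix. -/
theorem secondEigenvalue_trace_bounds (P : Matrix S S ℝ) (w : S → ℝ)
    (hw : ∀ x, 0 < w x) (hrev : ∀ x z, w x * P x z = w z * P z x)
    (hP : P ∈ Matrix.rowStochastic ℝ S) (hcard : 2 ≤ Fintype.card S) (m : ℕ) :
    1 + secondEigenvalue P ^ (2 * m) ≤ (P ^ (2 * m)).trace ∧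
      (P ^ (2 * m + 1)).trace ≤
        1 + (Fintype.card S - 1 : ℝ) * secondEigenvalue P ^ (2 * m + 1) := by
  have hspec := exists_eigenvalues_of_detailed_balance P w hw hrev
  obtain ⟨n, hn⟩ : ∃ n, Fintype.card S = n + 2 := ⟨Fintype.card S - 2, by omega⟩
  rw [hn] at hspec ⊢
  obtain ⟨μ, hanti, hsort, htr⟩ := hspec
  -- With at least two states the default value `0` of `getD` is never used.
  have hsecond : secondEigenvalue P = μ 1 := by
    rw [secondEigenvalue, hsort]
    simp [List.getD_eq_getElem?_getD]
  have hone : 1 ≤ μ 0 := by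
    have hroot : (1 : ℝ) ∈ P.charpoly.roots := by
      rw [Polynomial.mem_roots P.charpoly_monic.ne_zero, Polynomial.IsRoot,
        Matrix.eval_charpoly]
      have : Nonempty S := Fintype.card_pos_iff.1 (by omega)
      refine Matrix.exists_mulVec_eq_zero_iff.1 ⟨1, one_ne_zero, ?_⟩
      rw [Matrix.sub_mulVec, Matrix.one_vecMul_of_mem_rowStochastic hP]
      simp
    rw [← Multiset.mem_sort (r := (· ≥ ·)), hsort, List.mem_ofFn] at hroot
    obtain ⟨i, hi⟩ := hroot
    rw [← hi]
    exact hanti (Fin.zero_le i)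
  -- An eigenvalue above `1` would make even traces unbounded, yet a stochastic matrix has trace at
  -- most the number of states.
  have htop : μ 0 ≤ 1 := by
    by_contra! hlt
    obtain ⟨k, hk⟩ := pow_unbounded_of_one_lt (n + 2 : ℝ) (by nlinarith : 1 < μ 0 ^ 2)
    have h1 : μ 0 ^ (2 * k) ≤ ∑ i, μ i ^ (2 * k) :=
      Finset.single_le_sum (f := fun i => μ i ^ (2 * k))
        (fun i _ => (even_two_mul k).pow_nonneg _) (Finset.mem_univ 0)
    have h2 : (P ^ (2 * k)).trace ≤ n + 2 := by
      have : (P ^ (2 * k)).trace ≤ ∑ _x : S, (1 : ℝ) := Finset.sum_le_sum fun x _ =>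
        Matrix.le_one_of_mem_rowStochastic (pow_mem hP (2 * k))
      simpa [hn] using this
    rw [htr] at h2
    rw [← pow_mul] at hk
    linarith
  rw [hsecond, htr, htr]
  have h0 : μ 0 = 1 := le_antisymm htop hone
  constructor
  · rw [Fin.sum_univ_succ, Fin.sum_univ_succ, h0, one_pow]
    have : 0 ≤ ∑ i : Fin n, μ i.succ.succ ^ (2 * m) :=
      Finset.sum_nonneg fun i _ => (even_two_mul m).pow_nonneg _
    simp only [Fin.succ_zero_eq_one]
    linarith
  · rw [Fin.sum_univ_succ, h0, one_pow]
    -- Odd powers are monotone on all of `ℝ`, so negative eigenvalues do no harm.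
    have : ∑ i : Fin (n + 1), μ i.succ ^ (2 * m + 1) ≤ ∑ _i : Fin (n + 1), μ 1 ^ (2 * m + 1) :=
      Finset.sum_le_sum fun i _ => (Odd.strictMono_pow ⟨m, rfl⟩).monotone
        (hanti (by rw [← Fin.succ_zero_eq_one]; exact Fin.succ_le_succ_iff.2 (Fin.zero_le i)))
    rw [Finset.sum_const, Finset.card_univ, Fintype.card_fin, nsmul_eq_mul] at this
    push_cast at this ⊢
    linarith

/-- With equal total mass, an excess at `x` is compensated elsewhere, which cancels the factor `1 /
2`. -/
theorem sub_le_tvDist (μ ν : S → ℝ) (h : ∑ z, μ z = ∑ z, ν z) (x : S) :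
    μ x - ν x ≤ tvDist μ ν := by
  have hz : ∑ z, (μ z - ν z) = 0 := by rw [Finset.sum_sub_distrib, h, sub_self]
  rw [← Finset.add_sum_erase _ _ (Finset.mem_univ x)] at hz
  have h1 := Finset.abs_sum_le_sum_abs (fun z => μ z - ν z) (Finset.univ.erase x)
  have h2 := neg_abs_le (∑ z ∈ Finset.univ.erase x, (μ z - ν z))
  rw [tvDist, ← Finset.add_sum_erase _ _ (Finset.mem_univ x)]
  have h3 := le_abs_self (μ x - ν x)
  linarith

end Matrix

theorem sum_units_int (f : ℤˣ → ℝ) (ω : ℤˣ) : ∑ ω' : ℤˣ, f ω' = f ω + f (-ω) := by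
  have h : (Finset.univ : Finset ℤˣ) = {1, -1} := by decide
  rw [h, Finset.sum_pair (by decide)]
  rcases Int.units_eq_one_or ω with rfl | rfl
  · rfl
  · rw [neg_neg, add_comm]

/-! ### The chain at a fixed temperature. -/

section Chain

variable {N : ℕ} (H : Matrix (Fin N) (Fin N) ℝ) (y : EuclideanSpace ℝ (Fin N)) (α : ℝ)

theorem weight_pos (x : State N) : 0 < weight H y α x := Real.exp_pos _

theorem sum_weight_update_pos (x : State N) (j : Fin N) :
    0 < ∑ ω : ℤˣ, weight H y α (Function.update x j ω) :=
  Finset.sum_pos (fun _ _ => weight_pos H y α _) Finset.univ_nonempty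

theorem symbolProb_pos (x : State N) (j : Fin N) (ω : ℤˣ) : 0 < symbolProb H y α x j ω :=
  div_pos (weight_pos H y α _) (sum_weight_update_pos H y α x j)

theorem sum_symbolProb (x : State N) (j : Fin N) : ∑ ω : ℤˣ, symbolProb H y α x j ω = 1 := by
  simp only [symbolProb]
  rw [← Finset.sum_div, div_self (sum_weight_update_pos H y α x j).ne']

/-- A sum over the symbols that turn `x` into `z` by an update at `j` has at most one term. -/
theorem sum_update_eq (x z : State N) (j : Fin N) (a : ℤˣ → ℝ) :
    ∑ ω : ℤˣ, a ω * (if Function.update x j ω = z then 1 else 0) =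
      if Function.update x j (z j) = z then a (z j) else 0 := by
  rw [Finset.sum_eq_single (z j)]
  · rw [mul_ite, mul_one, mul_zero]
  · intro ω _ hω
    rw [if_neg, mul_zero]
    rintro rfl
    simp at hω
  · exact fun h => absurd (Finset.mem_univ _) h

theorem transition_apply (x z : State N) :
    transition H y α x z = ∑ j : Fin N, (1 / (N : ℝ)) *
      if Function.update x j (z j) = z then symbolProb H y α x j (z j) else 0 := by
  rw [transition, Matrix.of_apply]
  refine Finset.sum_congr rfl fun j _ => ?_
  rw [← sum_update_eq x z j fun ω => symbolProb H y α x j ω, Finset.mul_sum]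
  exact Finset.sum_congr rfl fun ω _ => mul_assoc _ _ _

theorem transition_apply_self (x : State N) :
    transition H y α x x = ∑ j : Fin N, (1 / (N : ℝ)) * symbolProb H y α x j (x j) := by
  simp [transition_apply]

theorem transition_nonneg (x z : State N) : 0 ≤ transition H y α x z := by
  rw [transition_apply]
  refine Finset.sum_nonneg fun j _ => mul_nonneg (by positivity) ?_
  split_ifs
  exacts [(symbolProb_pos H y α _ _ _).le, le_rfl]

theorem transition_update_pos (hN : 0 < N) (x : State N) (j : Fin N) (ω : ℤˣ) :
    0 < transition H y α x (Function.update x j ω) := by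
  rw [transition_apply]
  have hN' : (0 : ℝ) < 1 / N := by positivity
  refine Finset.sum_pos' (fun i _ => mul_nonneg hN'.le ?_) ⟨j, Finset.mem_univ j, ?_⟩
  · split_ifs
    exacts [(symbolProb_pos H y α _ _ _).le, le_rfl]
  · rw [Function.update_self, if_pos rfl]
    exact mul_pos hN' (symbolProb_pos H y α _ _ _)

theorem transition_mem_rowStochastic (hN : 0 < N) :
    transition H y α ∈ Matrix.rowStochastic ℝ (State N) := by
  rw [Matrix.mem_rowStochastic_iff_sum]
  refine ⟨transition_nonneg H y α, fun x => ?_⟩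
  have hN' : (N : ℝ) ≠ 0 := by positivity
  simp only [transition, Matrix.of_apply]
  rw [Finset.sum_comm]
  have : ∀ j : Fin N, ∑ z : State N, ∑ ω : ℤˣ, 1 / (N : ℝ) * symbolProb H y α x j ω *
      (if Function.update x j ω = z then 1 else 0) = 1 / (N : ℝ) := fun j => by
    rw [Finset.sum_comm]
    simp only [← Finset.mul_sum, Finset.sum_ite_eq, Finset.mem_univ, if_true, mul_one,
      sum_symbolProb]
  rw [Finset.sum_congr rfl fun j _ => this j, Finset.sum_const, Finset.card_univ,
    Fintype.card_fin, nsmul_eq_mul, mul_one_div_cancel hN']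

theorem transition_detailed_balance (x z : State N) :
    weight H y α x * transition H y α x z = weight H y α z * transition H y α z x := by
  rw [transition_apply, transition_apply, Finset.mul_sum, Finset.mul_sum]
  refine Finset.sum_congr rfl fun j _ => ?_
  have hiff : Function.update x j (z j) = z ↔ Function.update z j (x j) = x :=
    ⟨fun h => by rw [← h]; simp, fun h => by rw [← h]; simp⟩
  by_cases h : Function.update x j (z j) = z
  · have h' := hiff.1 h
    have hS : ∀ ω, Function.update z j ω = Function.update x j ω := fun ω => by
      rw [← h, Function.update_idem]
    rw [if_pos h, if_pos h', symbolProb, symbolProb, h, h']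
    simp only [hS]
    ring
  · rw [if_neg h, if_neg (mt hiff.2 h)]
    simp

theorem stationary_pos (x : State N) : 0 < stationary H y α x :=
  div_pos (weight_pos H y α _) (Finset.sum_pos (fun _ _ => weight_pos H y α _) Finset.univ_nonempty)

theorem sum_stationary : ∑ x, stationary H y α x = 1 := by
  simp only [stationary]
  rw [← Finset.sum_div, div_self]
  exact (Finset.sum_pos (fun _ _ => weight_pos H y α _) Finset.univ_nonempty).ne'

theorem stationary_le_one (x : State N) : stationary H y α x ≤ 1 := by
  rw [← sum_stationary H y α]
  exact Finset.single_le_sum (fun z _ => (stationary_pos H y α z).le) (Finset.mem_univ x)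

theorem stationary_vecMul_transition (hN : 0 < N) :
    Matrix.vecMul (stationary H y α) (transition H y α) = stationary H y α := by
  ext z
  have : ∀ x, stationary H y α x * transition H y α x z =
      stationary H y α z * transition H y α z x := fun x => by
    rw [stationary, stationary, div_mul_eq_mul_div, div_mul_eq_mul_div,
      transition_detailed_balance]
  simp only [Matrix.vecMul, dotProduct, this]
  rw [← Finset.mul_sum,
    Matrix.sum_row_of_mem_rowStochastic (transition_mem_rowStochastic H y α hN), mul_one]

/-- Correct the coordinates in `s` one at a time. For `s` the whole index set, this makes the `N`-th
power positive. -/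
theorem transition_pow_pos_of_eq_off (hN : 0 < N) (s : Finset (Fin N)) :
    ∀ x z : State N, (∀ j ∉ s, x j = z j) → 0 < (transition H y α ^ s.card) x z := by
  induction s using Finset.induction with
  | empty =>
    intro x z h
    rw [show x = z from funext fun j => h j (Finset.notMem_empty j)]
    simp
  | insert j s hj ih =>
    intro x z h
    rw [Finset.card_insert_of_notMem hj, pow_succ', Matrix.mul_apply]
    have hnn := fun u v => (pow_apply_self_ge (transition H y α) (transition_nonneg H y α)
      x s.card).1 u v
    refine Finset.sum_pos' (fun u _ => mul_nonneg (transition_nonneg H y α _ _) (hnn _ _))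
      ⟨Function.update x j (z j), Finset.mem_univ _,
        mul_pos (transition_update_pos H y α hN _ _ _) (ih _ _ fun i hi => ?_)⟩
    by_cases hij : i = j
    · subst hij; simp
    · rw [Function.update_of_ne hij]
      exact h i (by simp [hij, hi])

theorem tendsto_transition_pow (hN : 0 < N) (x z : State N) :
    Tendsto (fun k : ℕ => (transition H y α ^ (N * k)) x z) atTop (𝓝 (stationary H y α z)) := by
  have hstat : ∀ k : ℕ, Matrix.vecMul (stationary H y α) (transition H y α ^ k) =
      stationary H y α := fun k => by
    induction k with
    | zero => simp
    | succ k ih => rw [pow_succ, ← Matrix.vecMul_vecMul, ih, stationary_vecMul_transition H y α hN]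
  have h := tendsto_pow_of_pos (transition H y α ^ N) (stationary H y α)
    (fun x z => by
      simpa using transition_pow_pos_of_eq_off H y α hN Finset.univ x z (by simp))
    (fun x => Matrix.sum_row_of_mem_rowStochastic
      (pow_mem (transition_mem_rowStochastic H y α hN) N) x)
    (stationary_le_one H y α) (sum_stationary H y α) (fun z => congrFun (hstat N) z) x z
  simpa only [← pow_mul] using h

theorem two_le_card_state (hN : 0 < N) : 2 ≤ Fintype.card (State N) := by
  rw [Fintype.card_fun, Fintype.card_fin, Fintype.card_units_int]
  exact Nat.le_self_pow hN.ne' 2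

/-- Traces along multiples of `N` tend to the total stationary mass `1`, whereas `λ₂ ≥ 1` would keep
even traces at least `2`. Strictness allows multiplying through by `1 - λ₂`. -/
theorem secondEigenvalue_transition_lt_one (hN : 0 < N) :
    secondEigenvalue (transition H y α) < 1 := by
  by_contra! hge
  have hlim : Tendsto (fun k : ℕ => (transition H y α ^ (N * k)).trace) atTop (𝓝 1) := by
    rw [← sum_stationary H y α]
    exact tendsto_finsetSum _ fun x _ => tendsto_transition_pow H y α hN x x
  have hlim2 := hlim.comp (tendsto_id.const_mul_atTop' (two_pos : 0 < 2))
  have : (2 : ℝ) ≤ 1 := ge_of_tendsto' hlim2 fun k => by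
    have h := (secondEigenvalue_trace_bounds (transition H y α) (weight H y α)
      (weight_pos H y α) (transition_detailed_balance H y α)
      (transition_mem_rowStochastic H y α hN) (two_le_card_state hN) (N * k)).1
    have h1 := one_le_pow₀ hge (n := 2 * (N * k))
    simp only [Function.comp, id]
    rw [mul_left_comm]
    linarith
  norm_num at this

/-- Needed because `mixingTime` would be the junk value `0` if its defining set were empty. -/
theorem exists_tvDist_le (hN : 0 < N) {ε : ℝ} (hε : 0 < ε) :
    ∃ t : ℕ, ∀ x : State N,
      tvDist (fun z => (transition H y α ^ t) x z) (stationary H y α) ≤ ε := by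
  have hlim : ∀ x : State N, Tendsto (fun k : ℕ => tvDist
      (fun z => (transition H y α ^ (N * k)) x z) (stationary H y α)) atTop (𝓝 0) := fun x => by
    have : Tendsto (fun k : ℕ => (1 / 2 : ℝ) * ∑ z : State N,
        |(transition H y α ^ (N * k)) x z - stationary H y α z|) atTop
        (𝓝 ((1 / 2 : ℝ) * ∑ z : State N, |stationary H y α z - stationary H y α z|)) :=
      (tendsto_finsetSum _ fun z _ =>
        ((tendsto_transition_pow H y α hN x z).sub_const _).abs).const_mul _
    simpa [tvDist] using this
  obtain ⟨k, hk⟩ := (eventually_all.2 fun x => (hlim x).eventually_le_const hε).exists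
  exact ⟨N * k, hk⟩

/-- Probability of keeping a symbol whose change increases the objective by at least `c`. -/
theorem symbolProb_self_ge {x : State N} {j : Fin N} {c : ℝ}
    (hc : objective H y x + c ≤ objective H y (Function.update x j (-x j))) :
    1 - Real.exp (-(c * (1 / (2 * α ^ 2)))) ≤ symbolProb H y α x j (x j) := by
  have hβ : 0 ≤ 1 / (2 * α ^ 2) := by positivity
  rw [symbolProb, sum_units_int _ (x j), Function.update_eq_self]
  have h1 := weight_pos H y α x
  have h2 := weight_pos H y α (Function.update x j (-x j))
  have h3 : weight H y α (Function.update x j (-x j)) ≤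
      Real.exp (-(c * (1 / (2 * α ^ 2)))) * weight H y α x := by
    rw [weight, weight, ← Real.exp_add]
    refine Real.exp_le_exp.2 ?_
    nlinarith
  rw [le_div_iff₀ (by positivity)]
  nlinarith [Real.exp_pos (-(c * (1 / (2 * α ^ 2))))]

theorem transition_self_ge (hN : 0 < N) {x : State N} {c : ℝ}
    (hc : ∀ j, objective H y x + c ≤ objective H y (Function.update x j (-x j))) :
    1 - Real.exp (-(c * (1 / (2 * α ^ 2)))) ≤ transition H y α x x := by
  have hN' : (N : ℝ) ≠ 0 := by positivity
  rw [transition_apply_self, ← Finset.mul_sum]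
  have := Finset.card_nsmul_le_sum Finset.univ (fun j => symbolProb H y α x j (x j)) _
    fun j _ => symbolProb_self_ge H y α (hc j)
  rw [Finset.card_univ, Fintype.card_fin, nsmul_eq_mul] at this
  rw [one_div_mul_eq_div, le_div_iff₀' (by positivity)]
  exact this

theorem stationary_le_exp (x s : State N) :
    stationary H y α x ≤
      Real.exp (-((objective H y x - objective H y s) * (1 / (2 * α ^ 2)))) := by
  have h : weight H y α s ≤ ∑ u, weight H y α u :=
    Finset.single_le_sum (fun u _ => (weight_pos H y α u).le) (Finset.mem_univ s)
  refine (div_le_div_of_nonneg_left (weight_pos H y α x).le (weight_pos H y α s) h).trans ?_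
  rw [weight, weight, ← Real.exp_sub]
  refine Real.exp_le_exp.2 (le_of_eq ?_)
  ring

end Chain

/-! ### The zero-temperature limit. -/

section ZeroTemperature

variable {N : ℕ} (H : Matrix (Fin N) (Fin N) ℝ) (y : EuclideanSpace ℝ (Fin N))

theorem tendsto_inverse_temperature :
    Tendsto (fun α : ℝ => 1 / (2 * α ^ 2)) (𝓝[>] 0) atTop := by
  have h : Tendsto (fun α : ℝ => (α⁻¹) ^ 2 * (1 / 2)) (𝓝[>] 0) atTop :=
    (((tendsto_pow_atTop two_ne_zero).comp tendsto_inv_nhdsGT_zero).atTop_mul_const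
      (by norm_num))
  refine h.congr fun α => ?_
  rw [one_div, one_div, mul_inv, inv_pow, mul_comm]

theorem tendsto_exp_neg_mul_inverse_temperature {c : ℝ} (hc : 0 < c) :
    Tendsto (fun α : ℝ => Real.exp (-(c * (1 / (2 * α ^ 2))))) (𝓝[>] 0) (𝓝 0) :=
  Real.tendsto_exp_neg_atTop_nhds_zero.comp (tendsto_inverse_temperature.const_mul_atTop hc)

/-- The limiting chain as the temperature tends to zero: the selected position takes the symbol
with the smaller objective value. -/
noncomputable def greedyTransition : Matrix (State N) (State N) ℝ :=
  Matrix.of fun x z => ∑ j : Fin N, (1 / (N : ℝ)) *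
    if Function.update x j (z j) = z then
      if objective H y (Function.update x j (z j)) < objective H y (Function.update x j (-z j))
      then 1 else 0
    else 0

theorem update_ne_update_neg (x : State N) (j : Fin N) (ω : ℤˣ) :
    Function.update x j ω ≠ Function.update x j (-ω) := fun h => by
  have := congrFun h j
  rw [Function.update_self, Function.update_self] at this
  rcases Int.units_eq_one_or ω with rfl | rfl <;> revert this <;> decide

theorem tendsto_symbolProb
    (hinj : ∀ x x' : State N, objective H y x = objective H y x' → x = x')
    (x : State N) (j : Fin N) (ω : ℤˣ) :
    Tendsto (fun α => symbolProb H y α x j ω) (𝓝[>] 0)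
      (𝓝 (if objective H y (Function.update x j ω) < objective H y (Function.update x j (-ω))
        then 1 else 0)) := by
  set u := Function.update x j ω with hu
  set v := Function.update x j (-ω) with hv
  have hsum : ∀ α, symbolProb H y α x j ω =
      weight H y α u / (weight H y α u + weight H y α v) := fun α => by
    rw [symbolProb, sum_units_int _ ω]
  split_ifs with h
  · have hlim : Tendsto (fun α : ℝ => (1 + Real.exp
        (-((objective H y v - objective H y u) * (1 / (2 * α ^ 2)))))⁻¹) (𝓝[>] 0)
        (𝓝 (1 + 0)⁻¹) :=
      ((tendsto_exp_neg_mul_inverse_temperature (sub_pos.2 h)).const_add 1).inv₀ (by norm_num)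
    rw [add_zero, inv_one] at hlim
    refine hlim.congr fun α => ?_
    have hw : weight H y α v = weight H y α u * Real.exp
        (-((objective H y v - objective H y u) * (1 / (2 * α ^ 2)))) := by
      rw [weight, weight, ← Real.exp_add]
      congr 1
      ring
    rw [hsum, hw, ← mul_one_add, div_mul_cancel_left₀ (weight_pos H y α u).ne']
  · have hlt : objective H y v < objective H y u :=
      lt_of_le_of_ne (not_lt.1 h) fun he => update_ne_update_neg x j ω (hinj _ _ he).symm
    refine squeeze_zero (fun α => (symbolProb_pos H y α x j ω).le) (fun α => ?_)
      (tendsto_exp_neg_mul_inverse_temperature (sub_pos.2 hlt))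
    have hw : weight H y α u = weight H y α v * Real.exp
        (-((objective H y u - objective H y v) * (1 / (2 * α ^ 2)))) := by
      rw [weight, weight, ← Real.exp_add]
      congr 1
      ring
    rw [hsum, div_le_iff₀ (add_pos (weight_pos H y α u) (weight_pos H y α v))]
    nlinarith [mul_pos (weight_pos H y α u)
      (Real.exp_pos (-((objective H y u - objective H y v) * (1 / (2 * α ^ 2)))))]

theorem tendsto_transition
    (hinj : ∀ x x' : State N, objective H y x = objective H y x' → x = x') :
    Tendsto (fun α => transition H y α) (𝓝[>] 0) (𝓝 (greedyTransition H y)) := by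
  refine tendsto_pi_nhds.2 fun x => tendsto_pi_nhds.2 fun z => ?_
  simp only [transition_apply, greedyTransition, Matrix.of_apply]
  refine tendsto_finsetSum _ fun j _ => Tendsto.const_mul _ ?_
  split_ifs with h h'
  · simpa only [if_pos h'] using tendsto_symbolProb H y hinj x j (z j)
  · simpa only [if_neg h'] using tendsto_symbolProb H y hinj x j (z j)
  · exact tendsto_const_nhds

/-- A move between distinct states flips the chosen symbol, and the greedy rule flips only when the
objective strictly drops. -/
theorem greedyTransition_apply_eq_zero {x z : State N} (hxz : x ≠ z)
    (hle : objective H y x ≤ objective H y z) : greedyTransition H y x z = 0 := by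
  rw [greedyTransition, Matrix.of_apply]
  refine Finset.sum_eq_zero fun j _ => ?_
  split_ifs with h h'
  · exfalso
    have hj : x j = -z j := by
      have hne : x j ≠ z j := fun he => hxz (by rw [← h, ← he, Function.update_eq_self])
      revert hne
      generalize x j = a
      generalize z j = b
      decide +revert
    rw [h, ← hj, Function.update_eq_self] at h'
    exact absurd h' (not_lt.2 hle)
  · exact mul_zero _
  · exact mul_zero _

theorem greedyTransition_apply_self (x : State N) :
    greedyTransition H y x x = (Finset.univ.filter fun j =>
      objective H y x < objective H y (Function.update x j (-x j))).card / (N : ℝ) := by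
  simp only [greedyTransition, Matrix.of_apply, Function.update_eq_self, if_true]
  rw [← Finset.mul_sum, Finset.sum_boole, one_div, inv_mul_eq_div]

theorem greedyTransition_self_nonneg (x : State N) : 0 ≤ greedyTransition H y x x := by
  rw [greedyTransition_apply_self]
  positivity

theorem greedyTransition_self_le_one (x : State N) : greedyTransition H y x x ≤ 1 := by
  rw [greedyTransition_apply_self]
  refine div_le_one_of_le₀ ?_ (Nat.cast_nonneg N)
  exact_mod_cast (Finset.card_le_univ _).trans_eq (Fintype.card_fin N)

theorem greedyTransition_self_le (hN : 0 < N) {x : State N} {j : Fin N}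
    (hj : ¬ objective H y x < objective H y (Function.update x j (-x j))) :
    greedyTransition H y x x ≤ 1 - 1 / N := by
  have hN' : (0 : ℝ) < N := by positivity
  have hcard : (Finset.univ.filter fun j =>
      objective H y x < objective H y (Function.update x j (-x j))).card < N := by
    refine (Finset.card_lt_univ_of_notMem (x := j) (by simpa using hj)).trans_eq
      (Fintype.card_fin N)
  rw [greedyTransition_apply_self, div_le_iff₀ hN', sub_mul, one_div, inv_mul_cancel₀ hN'.ne',
    one_mul, le_sub_iff_add_le]
  exact_mod_cast hcard

end ZeroTemperature

/-! ### Relaxation and mixing times. -/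

section Main

variable {N : ℕ} (H : Matrix (Fin N) (Fin N) ℝ) (y : EuclideanSpace ℝ (Fin N))

theorem exists_gap {x : State N}
    (hx : ∀ j : Fin N, objective H y x < objective H y (Function.update x j (-x j))) :
    ∃ c : ℝ, 0 < c ∧
      ∀ j, objective H y x + c ≤ objective H y (Function.update x j (-x j)) := by
  rcases isEmpty_or_nonempty (Fin N) with hE | hE
  · exact ⟨1, one_pos, fun j => hE.elim j⟩
  · obtain ⟨j, hj⟩ := Finite.exists_min fun j : Fin N =>
      objective H y (Function.update x j (-x j))
    exact ⟨_, sub_pos.2 (hx j), fun i => by linarith [hj i]⟩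

theorem tendsto_transition_self_of_lt (hN : 0 < N) {x : State N}
    (hx : ∀ j : Fin N, objective H y x < objective H y (Function.update x j (-x j))) :
    Tendsto (fun α => transition H y α x x) (𝓝[>] 0) (𝓝 1) := by
  obtain ⟨c, hc, hgap⟩ := exists_gap H y hx
  have hlow := (tendsto_exp_neg_mul_inverse_temperature hc).const_sub 1
  rw [sub_zero] at hlow
  exact tendsto_of_tendsto_of_tendsto_of_le_of_le hlow tendsto_const_nhds
    (fun α => transition_self_ge H y α hN hgap)
    (fun α => Matrix.le_one_of_mem_rowStochastic (transition_mem_rowStochastic H y α hN))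

theorem relaxationTime_bounded (hN : 0 < N)
    (hinj : ∀ x x' : State N, objective H y x = objective H y x' → x = x')
    (hloc : ¬ ∃ x : State N, IsLocalMinimum H y x) :
    ∃ C : ℝ, ∀ᶠ α in 𝓝[>] (0 : ℝ), relaxationTime H y α ≤ C := by
  obtain ⟨g, hg⟩ := Finite.exists_min (objective H y)
  have hdiag : ∀ x ∈ Finset.univ.erase g, greedyTransition H y x x ≤ 1 - 1 / N := by
    intro x hx
    by_contra hlt
    refine hloc ⟨x, fun hmin => (Finset.ne_of_mem_erase hx)
      (hinj _ _ (le_antisymm (hmin g) (hg x))), fun j => ?_⟩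
    by_contra hj
    exact hlt (greedyTransition_self_le H y hN hj)
  have hN1 : (1 : ℝ) ≤ N := by exact_mod_cast hN
  have hr0 : (0 : ℝ) ≤ 1 - 1 / N := sub_nonneg.2 (div_le_one_of_le₀ hN1 (by positivity))
  have hr1 : (1 : ℝ) - 1 / N < 1 := sub_lt_self 1 (by positivity)
  set n : ℝ := ((Finset.univ.erase g : Finset (State N)).card : ℝ)
  have hlim : Tendsto (fun m : ℕ => n * (1 - 1 / N : ℝ) ^ (2 * m)) atTop (𝓝 (n * 0)) :=
    ((tendsto_pow_atTop_nhds_zero_of_lt_one hr0 hr1).comp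
      (tendsto_id.const_mul_atTop' (two_pos : 0 < 2))).const_mul n
  rw [mul_zero] at hlim
  obtain ⟨m, hm, hm0⟩ :=
    ((hlim.eventually_lt_const (by norm_num : (0 : ℝ) < 1 / 2)).and (eventually_gt_atTop 0)).exists
  have htrace : (greedyTransition H y ^ (2 * m)).trace < 3 / 2 := by
    have hpow := (pow_apply_self_of_triangular (greedyTransition H y) (objective H y)
      (fun x z => greedyTransition_apply_eq_zero H y) (2 * m)).2
    simp only [Matrix.trace, Matrix.diag_apply, hpow]
    rw [← Finset.add_sum_erase _ _ (Finset.mem_univ g)]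
    have h1 : greedyTransition H y g g ^ (2 * m) ≤ 1 :=
      pow_le_one₀ (greedyTransition_self_nonneg H y g) (greedyTransition_self_le_one H y g)
    have h2 := Finset.sum_le_card_nsmul (Finset.univ.erase g)
      (fun x => greedyTransition H y x x ^ (2 * m)) _ fun x hx =>
        pow_le_pow_left₀ (greedyTransition_self_nonneg H y x) (hdiag x hx) (2 * m)
    rw [nsmul_eq_mul] at h2
    linarith
  have hcont : Continuous fun P : Matrix (State N) (State N) ℝ => (P ^ (2 * m)).trace :=
    (continuous_id.pow (2 * m)).matrix_trace
  have hev := ((hcont.tendsto _).comp (tendsto_transition H y hinj)).eventually_lt_const htrace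
  -- The trace bound gives `l ^ (2 * m) < 1 / 2`; a gap below `1 / (4 * m)` would contradict this by
  -- Bernoulli's inequality.
  refine ⟨4 * m, hev.mono fun α hα => ?_⟩
  have hm1 : (1 : ℝ) ≤ m := by exact_mod_cast hm0
  have hb := (secondEigenvalue_trace_bounds (transition H y α) (weight H y α)
      (weight_pos H y α) (transition_detailed_balance H y α)
      (transition_mem_rowStochastic H y α hN) (two_le_card_state hN) m).1
  have hlt := secondEigenvalue_transition_lt_one H y α hN
  rw [relaxationTime]
  simp only [Function.comp] at hα
  set l := secondEigenvalue (transition H y α)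
  rw [div_le_iff₀ (sub_pos.2 hlt)]
  by_contra! hgap
  have hbern := one_add_mul_le_pow (a := -(1 - l)) (by nlinarith) (2 * m)
  rw [show 1 + -(1 - l) = l by ring] at hbern
  push_cast at hbern
  nlinarith

theorem not_relaxationTime_bounded (hN : 0 < N)
    (hinj : ∀ x x' : State N, objective H y x = objective H y x' → x = x')
    {x : State N} (hx : IsLocalMinimum H y x) :
    ¬ ∃ C : ℝ, ∀ᶠ α in 𝓝[>] (0 : ℝ), relaxationTime H y α ≤ C := by
  rintro ⟨C₀, hC₀⟩
  -- Enlarging the bound puts `1 - 1 / C` in `[0, 1)`.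
  obtain ⟨C, hC1, hC⟩ : ∃ C : ℝ, 1 ≤ C ∧ ∀ᶠ α in 𝓝[>] (0 : ℝ), relaxationTime H y α ≤ C :=
    ⟨max C₀ 1, le_max_right _ _, hC₀.mono fun α h => h.trans (le_max_left _ _)⟩
  obtain ⟨g, hg⟩ := Finite.exists_min (objective H y)
  have hgx : g ≠ x := fun h => hx.1 (h ▸ hg)
  have hglt : ∀ j : Fin N, objective H y g < objective H y (Function.update g j (-g j)) :=
    fun j => lt_of_le_of_ne (hg _) fun he => by
      have := update_ne_update_neg g j (g j)
      rw [Function.update_eq_self] at this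
      exact this (hinj _ _ he)
  have hr0 : 0 ≤ 1 - 1 / C := sub_nonneg.2 (div_le_one_of_le₀ hC1 (by positivity))
  have hr1 : 1 - 1 / C < 1 := sub_lt_self 1 (by positivity)
  set n : ℝ := Fintype.card (State N) - 1 with hn
  have hn0 : 0 ≤ n := by
    have : (2 : ℝ) ≤ Fintype.card (State N) := by exact_mod_cast two_le_card_state hN
    linarith
  have hlim : Tendsto (fun m : ℕ => n * (1 - 1 / C) ^ (2 * m + 1)) atTop (𝓝 (n * 0)) :=
    ((tendsto_pow_atTop_nhds_zero_of_lt_one hr0 hr1).comp ((tendsto_add_atTop_nat 1).comp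
      (tendsto_id.const_mul_atTop' (two_pos : 0 < 2)))).const_mul n
  rw [mul_zero] at hlim
  obtain ⟨m, hm⟩ := (hlim.eventually_lt_const (by norm_num : (0 : ℝ) < 1 / 2)).exists
  have hdiag := ((tendsto_transition_self_of_lt H y hN hglt).pow (2 * m + 1)).add
    ((tendsto_transition_self_of_lt H y hN hx.2).pow (2 * m + 1))
  rw [one_pow] at hdiag
  obtain ⟨α, hα, hrel⟩ :=
    ((hdiag.eventually_const_lt (by norm_num : (3 / 2 : ℝ) < 1 + 1)).and hC).exists
  have hb := (secondEigenvalue_trace_bounds (transition H y α) (weight H y α)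
      (weight_pos H y α) (transition_detailed_balance H y α)
      (transition_mem_rowStochastic H y α hN) (two_le_card_state hN) m).2
  have hpow := fun u => pow_apply_self_ge _ (transition_nonneg H y α) u (2 * m + 1)
  have htr : (transition H y α ^ (2 * m + 1)) g g + (transition H y α ^ (2 * m + 1)) x x ≤
      (transition H y α ^ (2 * m + 1)).trace := by
    rw [← Finset.sum_pair (f := fun u => (transition H y α ^ (2 * m + 1)) u u) hgx]
    exact Finset.sum_le_sum_of_subset_of_nonneg (Finset.subset_univ _)
      fun u _ _ => (hpow u).1 u u
  have hlt := secondEigenvalue_transition_lt_one H y α hN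
  have hle : secondEigenvalue (transition H y α) ≤ 1 - 1 / C := by
    rw [relaxationTime, div_le_iff₀ (sub_pos.2 hlt), ← div_le_iff₀' (by positivity)] at hrel
    linarith
  have hodd := (Odd.strictMono_pow (R := ℝ) (n := 2 * m + 1) ⟨m, rfl⟩).monotone hle
  have := mul_le_mul_of_nonneg_left hodd hn0
  linarith [(hpow g).2, (hpow x).2]

theorem exp_le_mixingTime (hN : 0 < N) {x : State N} (hx : IsLocalMinimum H y x) :
    ∃ c : ℝ, 0 < c ∧ ∀ ε : ℝ, 0 < ε → ε < 1 →
      ∀ᶠ α in 𝓝[>] (0 : ℝ),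
        Real.exp (c * (1 / (2 * α ^ 2))) ≤ (mixingTime H y α ε : ℝ) := by
  obtain ⟨c, hc, hgap⟩ := exists_gap H y hx.2
  obtain ⟨s, hs⟩ : ∃ s, objective H y s < objective H y x := by
    simpa using hx.1
  -- Half of the exponent is given up to absorb the factor `(1 - ε) / 2`, so the constant does not
  -- depend on `ε`.
  refine ⟨c / 2, by positivity, fun ε hε hε1 => ?_⟩
  have hε2 : 0 < (1 - ε) / 2 := by linarith
  filter_upwards [(tendsto_exp_neg_mul_inverse_temperature (sub_pos.2 hs)).eventually_lt_const hε2,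
    (tendsto_exp_neg_mul_inverse_temperature (half_pos hc)).eventually_lt_const hε2]
    with α hstat hexp
  have hmix := Nat.sInf_mem (exists_tvDist_le H y α hN hε) x
  change tvDist (fun z => (transition H y α ^ mixingTime H y α ε) x z) _ ≤ ε at hmix
  set t := mixingTime H y α ε
  set E := Real.exp (c / 2 * (1 / (2 * α ^ 2))) with hE
  have hE0 : 0 < E := Real.exp_pos _
  have hEinv : Real.exp (-(c / 2 * (1 / (2 * α ^ 2)))) = E⁻¹ := Real.exp_neg _
  have hδ : Real.exp (-(c * (1 / (2 * α ^ 2)))) = E⁻¹ * E⁻¹ := by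
    rw [← hEinv, ← Real.exp_add]
    congr 1
    ring
  have hself := transition_self_ge H y α hN hgap
  rw [hδ] at hself
  rw [hEinv] at hexp
  have hEi0 : 0 < E⁻¹ := inv_pos.2 hE0
  have hP := transition_mem_rowStochastic H y α hN
  have htv := sub_le_tvDist (fun z => (transition H y α ^ t) x z) (stationary H y α)
    (by rw [sum_stationary, Matrix.sum_row_of_mem_rowStochastic (pow_mem hP t)]) x
  have hbern := one_add_mul_le_pow (a := -(E⁻¹ * E⁻¹)) (by nlinarith) t
  have hpow : (1 + -(E⁻¹ * E⁻¹)) ^ t ≤ transition H y α x x ^ t :=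
    pow_le_pow_left₀ (by nlinarith) (by linarith) t
  have hret := (pow_apply_self_ge _ (transition_nonneg H y α) x t).2
  have hst := stationary_le_exp H y α x s
  -- Bernoulli gives `1 - t * E⁻² - π(x) ≤ ε`, and `π(x) < (1 - ε) / 2`.
  have hmain : (1 - ε) / 2 < t * (E⁻¹ * E⁻¹) := by linarith
  have : E⁻¹ < t * E⁻¹ * E⁻¹ := by linarith
  have h1 : 1 < t * E⁻¹ := by
    by_contra! h
    nlinarith
  rw [← div_eq_mul_inv, one_lt_div hE0] at h1
  exact h1.le

end Main

end ILS

theorem mainTheorem1 (N : ℕ) (hN : 0 < N)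
    (H : Matrix (Fin N) (Fin N) ℝ) (y : EuclideanSpace ℝ (Fin N))
    (hinj : ∀ x x' : ILS.State N,
      ILS.objective H y x = ILS.objective H y x' → x = x') :
    ((∃ C : ℝ, ∀ᶠ α in 𝓝[>] (0 : ℝ), ILS.relaxationTime H y α ≤ C) ↔
        ¬ ∃ x : ILS.State N, ILS.IsLocalMinimum H y x) ∧
    ((∃ x : ILS.State N, ILS.IsLocalMinimum H y x) →
        ∃ c : ℝ, 0 < c ∧ ∀ ε : ℝ, 0 < ε → ε < 1 →
          ∀ᶠ α in 𝓝[>] (0 : ℝ),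
            Real.exp (c * (1 / (2 * α ^ 2))) ≤ (ILS.mixingTime H y α ε : ℝ)) :=
  ⟨⟨fun hC ⟨_, hx⟩ => ILS.not_relaxationTime_bounded H y hN hinj hx hC,
    ILS.relaxationTime_bounded H y hN hinj⟩,
    fun ⟨_, hx⟩ => ILS.exp_le_mixingTime H y hN hx⟩
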